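/- Let $H\in(0,1)$ and let $S^H=\{S^H_t,\ t\ge 0\}$ be a sub-fractional Brownian motion with parameter $H$ on a probability space $(\Omega,\mathcal F,\mathbb P)$, that is, a centred Gaussian process with covariance $$\mathbb E(S^H_sS^H_t)=s^{2H}+t^{2H}-\tfrac12\left[(s+t)^{2H}+|s-t|^{2H}\right],\qquad s,t\ge 0,$$ which is (up to a null set) jointly measurable in $(t,\omega)\in(0,1)\times\Omega$; for instance, one with almost surely continuous paths. Let $I=(0,1)$ and, for $h\in\mathbb R$, let $I(h)=\{s\in I: s+h\in I\}$. For measurable $A\subseteq I$ and a measurable function $g$ on $A$ put $$\|g\|_{L^{\Phi_2}(A)}=\sup_{p\ge 1}p^{-1/2}\|g\|_{L^p(A)},$$ a norm of the exponential Orlicz space of the Young function $\Phi_2(x)=e^{x^2}-1$. Let $\mathcal B^{H}_{\Phi_2,\infty}(I)$ be the Besov--Orlicz space of all measurable $f$ on $I$ with $\|f\|_{L^{\Phi_2}(I)}<\infty$ and $$\sup_{0<t\le 1}t^{-H}\sup_{|h|\le t}\|f(\cdot+h)-f(\cdot)\|_{L^{\Phi_2}(I(h))}<\infty .$$ Then,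 for $\mathbb P$-almost every $\omega$, the path $t\mapsto S^H_t(\omega)$, $t\in I$, belongs to $\mathcal B^{H}_{\Phi_2,\infty}(I)$. -/

import Mathlib

open MeasureTheory ProbabilityTheory Set
open scoped NNReal ENNReal

noncomputable section

/-- The set `I(h) = {s ∈ I : s + h ∈ I}` for the interval `I = (0, 1)`. -/
def shiftDomain (h : ℝ) : Set ℝ :=
  {s | s ∈ Ioo (0 : ℝ) 1 ∧ s + h ∈ Ioo (0 : ℝ) 1}

/-- The norm of the exponential Orlicz space `L^{Φ_β}(A)`, where `Φ_β(x) = exp(x^β) - 1`: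
the supremum of `p^{-1/β} ‖f‖_{L^p(A)}` over all real `p ≥ 1`, with values in `[0, ∞]`. -/
def expOrliczNorm (β : ℝ) (f : ℝ → ℝ) (A : Set ℝ) : ℝ≥0∞ :=
  ⨆ (p : ℝ) (_ : 1 ≤ p),
    ENNReal.ofReal (p ^ (-(1 / β))) * eLpNorm f (ENNReal.ofReal p) (volume.restrict A)

/-- The modulus of smoothness of `f` on `(0, 1)` in the exponential Orlicz norm: the supremum
over `|h| ≤ t` of the `L^{Φ_β}(I(h))`-norm of `s ↦ f (s + h) - f s`. -/
def orliczModulus (β : ℝ) (f : ℝ → ℝ) (t : ℝ) : ℝ≥0∞ :=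
  ⨆ (h : ℝ) (_ : |h| ≤ t), expOrliczNorm β (fun s => f (s + h) - f s) (shiftDomain h)

/-- The Besov-Orlicz seminorm: the supremum over `0 < t ≤ 1` of `t^{-α}` times the modulus. -/
def besovOrliczSeminorm (α β : ℝ) (f : ℝ → ℝ) : ℝ≥0∞ :=
  ⨆ (t : ℝ) (_ : 0 < t ∧ t ≤ 1), ENNReal.ofReal (t ^ (-α)) * orliczModulus β f t

/-- The Besov-Orlicz space of smoothness `α` on `(0, 1)` for the Young function `Φ_β` and third
index `∞`, as a set of functions `f : ℝ → ℝ`, of which only the values on `(0, 1)` matter. -/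
def BesovOrliczSpace (α β : ℝ) : Set (ℝ → ℝ) :=
  {f | AEMeasurable f (volume.restrict (Ioo (0 : ℝ) 1)) ∧
    expOrliczNorm β f (Ioo (0 : ℝ) 1) < ∞ ∧
    besovOrliczSeminorm α β f < ∞}

/-- `S` is a sub-fractional Brownian motion with parameter `H` under `P`: a centred Gaussian
process on `[0, ∞)` with the sub-fractional covariance function. -/
structure IsSubfractionalBrownianMotion {Ω : Type*} [MeasurableSpace Ω] (H : ℝ)
    (S : ℝ≥0 → Ω → ℝ) (P : Measure Ω) : Prop where
  isGaussianProcess : IsGaussianProcess S P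
  centred : ∀ t : ℝ≥0, ∫ ω, S t ω ∂P = 0
  covariance_eq : ∀ s t : ℝ≥0, cov[S s, S t; P] =
    (s : ℝ) ^ (2 * H) + (t : ℝ) ^ (2 * H)
      - (1 / 2) * (((s : ℝ) + (t : ℝ)) ^ (2 * H) + |(s : ℝ) - (t : ℝ)| ^ (2 * H))

end

/-!
For a centred Gaussian increment of variance at most `K δ ^ (2 * H)`, `exp (c (Δ / δ ^ H) ^ 2)` has
a finite mean once `c K` is small, and its spatial integrals at the dyadic steps `δ = 2⁻ⁿ` have
bounded means. Their fluctuations above the mean are summable in `L²`: by the Hubbard–Stratonovich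
identity, the covariance of two such exponentials is controlled by the covariance of the increments
over `K δ ^ (2 * H)`. For sub-fractional Brownian motion this is at most `1` near the diagonal and,
by the mean value theorem for second differences of `|x| ^ (2 * H)`, a positive power of `δ` at
distance at least `δ + √δ`. Hence almost surely all dyadic spatial integrals are bounded at once,
which bounds `p ^ (-1/2) ‖Δ‖_p / δ ^ H` uniformly in `p ≥ 1` and `n`.

An arbitrary step `h` is a limit of finite sums of dyadic ones. Writing the increment over each
partial sum telescopically and letting the partial sums tend to `h`, continuity of translations in
`L^p` extends the bound to all `h`, with a geometric series as the only loss.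
-/

open Filter Topology
open scoped fwdDiff

section ShiftDomain

lemma measurableSet_shiftDomain (h : ℝ) : MeasurableSet (shiftDomain h) :=
  measurableSet_Ioo.inter (measurableSet_Ioo.preimage (measurable_id.add_const h))

lemma shiftDomain_subset_Ioo (h : ℝ) : shiftDomain h ⊆ Ioo 0 1 :=
  fun _ hs => hs.1

lemma volume_shiftDomain_le_one (h : ℝ) : volume (shiftDomain h) ≤ 1 :=
  (measure_mono (shiftDomain_subset_Ioo h)).trans_eq (by simp)

lemma mapsTo_add_right_shiftDomain (h : ℝ) : MapsTo (· + h) (shiftDomain h) (Ioo 0 1) :=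
  fun _ hs => hs.2

lemma antitoneOn_shiftDomain : AntitoneOn shiftDomain (Ici 0) :=
  fun a ha _ _ hab s hs =>
    ⟨hs.1, by linarith [hs.1.1, mem_Ici.1 ha], by linarith [hs.2.2]⟩

lemma mapsTo_add_right_shiftDomain_add {a b : ℝ} (ha : 0 ≤ a) (hb : 0 ≤ b) :
    MapsTo (· + a) (shiftDomain (a + b)) (shiftDomain b) :=
  fun s hs => ⟨⟨by linarith [hs.1.1], by linarith [hs.2.2]⟩,
    by simpa only [add_assoc] using hs.2⟩

lemma mapsTo_sub_right_shiftDomain_neg (h : ℝ) :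
    MapsTo (· + -h) (shiftDomain (-h)) (shiftDomain h) :=
  fun s hs => ⟨hs.2, by simpa only [neg_add_cancel_right] using hs.1⟩

lemma quasiMeasurePreserving_add_right_restrict {s t : Set ℝ} {a : ℝ} (h : MapsTo (· + a) s t) :
    Measure.QuasiMeasurePreserving (· + a) (volume.restrict s) (volume.restrict t) :=
  (measurePreserving_add_right volume a).quasiMeasurePreserving.restrict h

lemma aemeasurable_fwdDiff_shiftDomain {f : ℝ → ℝ}
    (hf : AEMeasurable f (volume.restrict (Ioo 0 1))) (h : ℝ) :
    AEMeasurable (Δ_[h] f) (volume.restrict (shiftDomain h)) :=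
  (hf.comp_quasiMeasurePreserving
    (quasiMeasurePreserving_add_right_restrict (mapsTo_add_right_shiftDomain h))).sub
    (hf.mono_set (shiftDomain_subset_Ioo h))

end ShiftDomain

section ExpOrliczNorm

variable {β : ℝ} {f g : ℝ → ℝ} {s t : Set ℝ}

lemma expOrliczNorm_zero : expOrliczNorm β 0 s = 0 := by
  simp [expOrliczNorm]

lemma expOrliczNorm_neg : expOrliczNorm β (-f) s = expOrliczNorm β f s := by
  simp only [expOrliczNorm, eLpNorm_neg]

lemma expOrliczNorm_mono_set (hst : s ⊆ t) : expOrliczNorm β f s ≤ expOrliczNorm β f t :=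
  iSup₂_mono fun _ _ =>
    mul_le_mul_right (eLpNorm_mono_measure _ (Measure.restrict_mono_set _ hst)) _

lemma expOrliczNorm_add_le (hf : AEMeasurable f (volume.restrict s))
    (hg : AEMeasurable g (volume.restrict s)) :
    expOrliczNorm β (f + g) s ≤ expOrliczNorm β f s + expOrliczNorm β g s := by
  refine iSup₂_le fun p hp => ?_
  grw [eLpNorm_add_le hf.aestronglyMeasurable hg.aestronglyMeasurable (ENNReal.one_le_ofReal.2 hp),
    mul_add]
  exact add_le_add (le_iSup₂_of_le p hp le_rfl) (le_iSup₂_of_le p hp le_rfl)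

lemma expOrliczNorm_comp_add_right_le {a : ℝ} (h : MapsTo (· + a) s t) :
    expOrliczNorm β (fun x => f (x + a)) s ≤ expOrliczNorm β f t := by
  refine iSup₂_mono fun p _ => mul_le_mul_right ?_ _
  have hmp := (measurePreserving_add_right (volume : Measure ℝ) a).restrict_preimage_emb
    (measurableEmbedding_addRight a) t
  calc eLpNorm (fun x => f (x + a)) (ENNReal.ofReal p) (volume.restrict s)
      ≤ eLpNorm (fun x => f (x + a)) (ENNReal.ofReal p) (volume.restrict ((· + a) ⁻¹' t)) :=
        eLpNorm_mono_measure _ (Measure.restrict_mono_set _ h)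
    _ = eLpNorm f (ENNReal.ofReal p) (volume.restrict t) := by
        rw [← hmp.map_eq, (measurableEmbedding_addRight a).eLpNorm_map_measure]
        rfl

lemma eLpNorm_lt_top_of_expOrliczNorm (hf : expOrliczNorm β f s < ∞) {p : ℝ} (hp : 1 ≤ p) :
    eLpNorm f (ENNReal.ofReal p) (volume.restrict s) < ∞ := by
  have hweight : ENNReal.ofReal (p ^ (-(1 / β))) ≠ 0 := by
    simpa using Real.rpow_pos_of_pos (zero_lt_one.trans_le hp) _
  have hmul := (le_iSup₂_of_le (f := fun (q : ℝ) (_ : 1 ≤ q) => ENNReal.ofReal (q ^ (-(1 / β))) *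
    eLpNorm f (ENNReal.ofReal q) (volume.restrict s)) p hp le_rfl).trans_lt hf
  exact ENNReal.lt_top_of_mul_ne_top_right hmul.ne hweight

end ExpOrliczNorm

section IncrementNorm

/-- The exponential Orlicz norm of the increment `s ↦ f (s + h) - f s` over its natural domain
`I(h)`: the quantity whose supremum over `|h| ≤ t` is `orliczModulus β f t`. -/
noncomputable def incrementNorm (β : ℝ) (f : ℝ → ℝ) (h : ℝ) : ℝ≥0∞ :=
  expOrliczNorm β (Δ_[h] f) (shiftDomain h)

variable {β h : ℝ} {f : ℝ → ℝ} {C : ℝ≥0∞}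

lemma incrementNorm_zero : incrementNorm β f 0 = 0 := by
  have hzero : Δ_[(0 : ℝ)] f = 0 := by ext; simp [fwdDiff]
  rw [incrementNorm, hzero, expOrliczNorm_zero]

lemma incrementNorm_neg_le : incrementNorm β f (-h) ≤ incrementNorm β f h := by
  have hflip : Δ_[-h] f = -fun s => Δ_[h] f (s + -h) := by ext; simp [fwdDiff]
  rw [incrementNorm, hflip, expOrliczNorm_neg]
  exact expOrliczNorm_comp_add_right_le (mapsTo_sub_right_shiftDomain_neg h)

lemma incrementNorm_le_abs : incrementNorm β f h ≤ incrementNorm β f |h| := by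
  rcases abs_choice h with habs | habs
  · rw [habs]
  · simpa only [habs, neg_neg] using incrementNorm_neg_le (β := β) (f := f) (h := -h)

lemma incrementNorm_add_le (hf : AEMeasurable f (volume.restrict (Ioo 0 1))) {a b : ℝ}
    (ha : 0 ≤ a) (hb : 0 ≤ b) :
    incrementNorm β f (a + b) ≤ incrementNorm β f a + incrementNorm β f b := by
  have hsplit : Δ_[a + b] f = Δ_[a] f + fun s => Δ_[b] f (s + a) := by
    ext; simp [fwdDiff, add_assoc]
  have hmaps := mapsTo_add_right_shiftDomain_add ha hb
  have hsub : shiftDomain (a + b) ⊆ shiftDomain a :=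
    antitoneOn_shiftDomain ha (add_nonneg ha hb) (le_add_of_nonneg_right hb)
  rw [incrementNorm, hsplit]
  refine (expOrliczNorm_add_le ((aemeasurable_fwdDiff_shiftDomain hf a).mono_set hsub)
    ((aemeasurable_fwdDiff_shiftDomain hf b).comp_quasiMeasurePreserving
      (quasiMeasurePreserving_add_right_restrict hmaps))).trans ?_
  exact add_le_add (expOrliczNorm_mono_set hsub) (expOrliczNorm_comp_add_right_le hmaps)

lemma tendsto_eLpNorm_translate_sub {g : ℝ → ℝ} {p : ℝ≥0∞} (hp : 1 ≤ p) (hp' : p ≠ ∞)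
    (hg : MemLp g p volume) {u : ℕ → ℝ} (hu : Tendsto u atTop (𝓝 h)) :
    Tendsto (fun n => eLpNorm (fun s => g (s + h) - g (s + u n)) p volume) atTop (𝓝 0) := by
  have : Fact (1 ≤ p) := ⟨hp⟩
  have : Fact (p ≠ ∞) := ⟨hp'⟩
  have hvadd : Tendsto (fun n => DomAddAct.mk (u n) +ᵥ hg.toLp g) atTop
      (𝓝 (DomAddAct.mk h +ᵥ hg.toLp g)) :=
    ((DomAddAct.continuous_mk.tendsto h).comp hu).vadd tendsto_const_nhds
  simp only [DomAddAct.mk_vadd_toLp] at hvadd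
  rw [Lp.tendsto_Lp_iff_tendsto_eLpNorm''] at hvadd
  refine hvadd.congr fun n => ?_
  rw [eLpNorm_sub_comm]
  congr 1 with s
  simp only [Pi.sub_apply, vadd_eq_add, add_comm s]

lemma eLpNorm_fwdDiff_le_add {p : ℝ≥0∞} (hp : 1 ≤ p)
    (hf : AEMeasurable f (volume.restrict (Ioo 0 1))) {u : ℝ} (hu : 0 ≤ u) (huh : u ≤ h) :
    eLpNorm (Δ_[h] f) p (volume.restrict (shiftDomain h)) ≤
      eLpNorm (Δ_[u] f) p (volume.restrict (shiftDomain u)) +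
      eLpNorm (fun s => (Ioo 0 1).indicator f (s + h) - (Ioo 0 1).indicator f (s + u)) p
        volume := by
  have hsub : shiftDomain h ⊆ shiftDomain u := antitoneOn_shiftDomain hu (hu.trans huh) huh
  have hsplit : Δ_[h] f =ᵐ[volume.restrict (shiftDomain h)] Δ_[u] f +
      fun s => (Ioo 0 1).indicator f (s + h) - (Ioo 0 1).indicator f (s + u) := by
    filter_upwards [ae_restrict_mem (measurableSet_shiftDomain h)] with s hs
    simp [fwdDiff, indicator_of_mem hs.2, indicator_of_mem (hsub hs).2]
  have hind : AEMeasurable ((Ioo 0 1).indicator f) volume :=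
    (aemeasurable_indicator_iff measurableSet_Ioo).2 hf
  have htrans (a : ℝ) : AEMeasurable (fun s => (Ioo 0 1).indicator f (s + a)) volume :=
    hind.comp_quasiMeasurePreserving (measurePreserving_add_right volume a).quasiMeasurePreserving
  rw [eLpNorm_congr_ae hsplit]
  refine (eLpNorm_add_le
    ((aemeasurable_fwdDiff_shiftDomain hf u).mono_set hsub).aestronglyMeasurable
    ((htrans h).sub (htrans u)).restrict.aestronglyMeasurable hp).trans ?_
  exact add_le_add (eLpNorm_mono_measure _ (Measure.restrict_mono_set _ hsub))
    (eLpNorm_mono_measure _ Measure.restrict_le_self)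

lemma incrementNorm_le_of_tendsto (hf : AEMeasurable f (volume.restrict (Ioo 0 1)))
    (hnorm : expOrliczNorm β f (Ioo 0 1) < ∞) {u : ℕ → ℝ} (hu : Tendsto u atTop (𝓝 h))
    (hu0 : ∀ n, 0 ≤ u n) (huh : ∀ n, u n ≤ h) (hC : ∀ n, incrementNorm β f (u n) ≤ C) :
    incrementNorm β f h ≤ C := by
  refine iSup₂_le fun p hp => ?_
  have hp' : 1 ≤ ENNReal.ofReal p := ENNReal.one_le_ofReal.2 hp
  have hmem : MemLp ((Ioo 0 1).indicator f) (ENNReal.ofReal p) volume :=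
    (memLp_indicator_iff_restrict measurableSet_Ioo).2
      ⟨hf.aestronglyMeasurable, eLpNorm_lt_top_of_expOrliczNorm hnorm hp⟩
  have hlim := (ENNReal.Tendsto.const_mul (a := ENNReal.ofReal (p ^ (-(1 / β))))
    (tendsto_eLpNorm_translate_sub hp' ENNReal.ofReal_ne_top hmem hu)
    (Or.inr ENNReal.ofReal_ne_top)).const_add C
  rw [mul_zero, add_zero] at hlim
  refine ge_of_tendsto' hlim fun n => ?_
  grw [eLpNorm_fwdDiff_le_add hp' hf (hu0 n) (huh n), mul_add, ← hC n]
  gcongr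
  exact le_iSup₂_of_le p hp le_rfl

end IncrementNorm

section DyadicChaining

variable {α : ℝ} {A : ℝ≥0∞} {N : ℝ → ℝ≥0∞}

lemma le_sum_dyadic_of_subadditive (hzero : N 0 = 0)
    (hadd : ∀ a b, 0 ≤ a → 0 ≤ b → N (a + b) ≤ N a + N b) (m i : ℕ) {k : ℕ} (hk : k ≤ 2 ^ i) :
    N (k / 2 ^ (m + i)) ≤ ∑ l ∈ Finset.range (i + 1), N ((1 / 2) ^ (m + l)) := by
  induction i generalizing k with
  | zero =>
    rw [pow_zero] at hk
    interval_cases k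
    · simp [hzero]
    · simp
  | succ i ih =>
    rw [Finset.sum_range_succ]
    obtain ⟨r, rfl | rfl⟩ := k.even_or_odd'
    · have heven : ((2 * r : ℕ) : ℝ) / 2 ^ (m + (i + 1)) = r / 2 ^ (m + i) := by
        push_cast; rw [← add_assoc, pow_succ]; field_simp
      rw [heven]
      exact (ih (by rw [pow_succ] at hk; omega)).trans le_self_add
    · have hodd : ((2 * r + 1 : ℕ) : ℝ) / 2 ^ (m + (i + 1)) =
          r / 2 ^ (m + i) + (1 / 2) ^ (m + (i + 1)) := by
        push_cast; rw [← add_assoc, pow_succ, one_div_pow, pow_succ]; field_simp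
      rw [hodd]
      exact (hadd _ _ (by positivity) (by positivity)).trans
        (add_le_add_left (ih (by rw [pow_succ] at hk; omega)) _)

lemma sum_dyadic_rpow_le (hα : 0 < α) (m k : ℕ) :
    ∑ l ∈ Finset.range k, ENNReal.ofReal (((1 / 2) ^ (m + l)) ^ α) ≤
      ENNReal.ofReal (((1 / 2) ^ α * (1 - (1 / 2) ^ α))⁻¹ * ((1 / 2) ^ (m + 1)) ^ α) := by
  set q : ℝ := (1 / 2) ^ α with hq
  have hq0 : 0 < q := by positivity
  have hq1 : q < 1 := Real.rpow_lt_one (by norm_num) (by norm_num) hα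
  have hpow (n : ℕ) : ((1 / 2 : ℝ) ^ n) ^ α = q ^ n := by
    rw [hq, Real.rpow_pow_comm (by norm_num)]
  simp only [hpow]
  rw [← ENNReal.ofReal_sum_of_nonneg fun _ _ => by positivity]
  refine ENNReal.ofReal_le_ofReal ?_
  calc ∑ l ∈ Finset.range k, q ^ (m + l) = q ^ m * ∑ l ∈ Finset.range k, q ^ l := by
        simp only [pow_add, Finset.mul_sum]
    _ ≤ q ^ m * (1 - q)⁻¹ := by
        gcongr
        exact tsum_geometric_of_lt_one hq0.le hq1 ▸
          (summable_geometric_of_lt_one hq0.le hq1).sum_le_tsum _ fun l _ => by positivity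
    _ = (q * (1 - q))⁻¹ * q ^ (m + 1) := by
        rw [mul_inv, pow_succ]; field_simp

lemma le_rpow_of_dyadic_of_subadditive (hα : 0 < α) (hzero : N 0 = 0)
    (hadd : ∀ a b, 0 ≤ a → 0 ≤ b → N (a + b) ≤ N a + N b)
    (hclosed : ∀ (h : ℝ) (u : ℕ → ℝ) (C : ℝ≥0∞), Tendsto u atTop (𝓝 h) → (∀ n, 0 ≤ u n) →
      (∀ n, u n ≤ h) → (∀ n, N (u n) ≤ C) → N h ≤ C)
    (hdyadic : ∀ n : ℕ, N ((1 / 2) ^ n) ≤ A * ENNReal.ofReal (((1 / 2) ^ n) ^ α))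
    {h : ℝ} (h0 : 0 ≤ h) (h1 : h ≤ 1) :
    N h ≤ A * ENNReal.ofReal (((1 / 2) ^ α * (1 - (1 / 2) ^ α))⁻¹ * h ^ α) := by
  rcases h0.eq_or_lt with rfl | h0
  · simp [hzero]
  obtain ⟨m, hm, hm'⟩ := exists_nat_pow_near_of_lt_one h0 h1 (y := (1 / 2 : ℝ))
    (by norm_num) (by norm_num)
  have hq1 : (1 / 2 : ℝ) ^ α < 1 := Real.rpow_lt_one (by norm_num) (by norm_num) hα
  have hfloor : Tendsto (fun i : ℕ => (⌊h * 2 ^ (m + i)⌋₊ : ℝ) / 2 ^ (m + i)) atTop (𝓝 h) := by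
    refine (tendsto_nat_floor_mul_div_atTop h0.le).comp
      ((tendsto_pow_atTop_atTop_of_one_lt (one_lt_two : (1 : ℝ) < 2)).comp
        (tendsto_add_atTop_nat m)) |>.congr fun i => ?_
    simp only [Function.comp_apply, add_comm i m]
  refine hclosed h _ _ hfloor (fun i => by positivity) (fun i => ?_) fun i => ?_
  · rw [div_le_iff₀ (by positivity)]
    exact Nat.floor_le (by positivity)
  have hk : ⌊h * 2 ^ (m + i)⌋₊ ≤ 2 ^ i := by
    refine Nat.floor_le_of_le ?_
    push_cast
    calc h * 2 ^ (m + i) ≤ (1 / 2) ^ m * 2 ^ (m + i) := by gcongr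
      _ = 2 ^ i := by rw [pow_add, one_div_pow]; field_simp
  calc N (⌊h * 2 ^ (m + i)⌋₊ / 2 ^ (m + i))
      ≤ ∑ l ∈ Finset.range (i + 1), N ((1 / 2) ^ (m + l)) :=
        le_sum_dyadic_of_subadditive hzero hadd m i hk
    _ ≤ A * ∑ l ∈ Finset.range (i + 1), ENNReal.ofReal (((1 / 2) ^ (m + l)) ^ α) := by
        rw [Finset.mul_sum]
        exact Finset.sum_le_sum fun l _ => hdyadic _
    _ ≤ A * ENNReal.ofReal (((1 / 2) ^ α * (1 - (1 / 2) ^ α))⁻¹ * h ^ α) := by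
        grw [sum_dyadic_rpow_le hα]
        have : 0 ≤ 1 - (1 / 2 : ℝ) ^ α := by linarith
        gcongr

end DyadicChaining

section Membership

variable {α β : ℝ} {f : ℝ → ℝ} {A : ℝ≥0∞}

lemma orliczModulus_eq_iSup_incrementNorm (t : ℝ) :
    orliczModulus β f t = ⨆ (h : ℝ) (_ : |h| ≤ t), incrementNorm β f h :=
  rfl

lemma besovOrliczSeminorm_le_of_incrementNorm_le (hα : 0 ≤ α)
    (hA : ∀ h, 0 ≤ h → h ≤ 1 → incrementNorm β f h ≤ A * ENNReal.ofReal (h ^ α)) :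
    besovOrliczSeminorm α β f ≤ A := by
  refine iSup₂_le fun t ⟨ht0, ht1⟩ => ?_
  have hmodulus : orliczModulus β f t ≤ A * ENNReal.ofReal (t ^ α) := by
    rw [orliczModulus_eq_iSup_incrementNorm]
    refine iSup₂_le fun h hht => ?_
    grw [incrementNorm_le_abs, hA _ (abs_nonneg h) (hht.trans ht1), hht]
  grw [hmodulus, mul_left_comm, ← ENNReal.ofReal_mul (by positivity), ← Real.rpow_add ht0,
    neg_add_cancel, Real.rpow_zero, ENNReal.ofReal_one, mul_one]

theorem mem_besovOrliczSpace_of_dyadic (hα : 0 < α)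
    (hf : AEMeasurable f (volume.restrict (Ioo 0 1)))
    (hnorm : expOrliczNorm β f (Ioo 0 1) < ∞) (hA : A ≠ ∞)
    (hdyadic : ∀ n : ℕ,
      incrementNorm β f ((1 / 2) ^ n) ≤ A * ENNReal.ofReal (((1 / 2) ^ n) ^ α)) :
    f ∈ BesovOrliczSpace α β := by
  refine ⟨hf, hnorm, ?_⟩
  have hq1 : (1 / 2 : ℝ) ^ α < 1 := Real.rpow_lt_one (by norm_num) (by norm_num) hα
  have hconst : 0 ≤ ((1 / 2 : ℝ) ^ α * (1 - (1 / 2) ^ α))⁻¹ :=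
    inv_nonneg.2 (mul_nonneg (by positivity) (by linarith))
  refine (besovOrliczSeminorm_le_of_incrementNorm_le hα.le fun h h0 h1 => ?_).trans_lt
    (ENNReal.mul_lt_top hA.lt_top
      (ENNReal.ofReal_lt_top (r := ((1 / 2 : ℝ) ^ α * (1 - (1 / 2) ^ α))⁻¹)))
  rw [mul_assoc, ← ENNReal.ofReal_mul hconst]
  exact le_rpow_of_dyadic_of_subadditive hα incrementNorm_zero
    (fun _ _ => incrementNorm_add_le hf) (fun _ _ _ => incrementNorm_le_of_tendsto hf hnorm)
    hdyadic h0 h1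

end Membership

section ExpMoment

/-- The exponential moment `∫ exp (c |f|^β) dμ`, whose finiteness for some `c > 0`
characterises the exponential Orlicz space `L^{Φ_β}(μ)` when `μ` is finite. -/
noncomputable def expMoment {E : Type*} [MeasurableSpace E] (β : ℝ) (f : E → ℝ)
    (μ : Measure E) (c : ℝ) : ℝ≥0∞ :=
  ∫⁻ x, ENNReal.ofReal (Real.exp (c * |f x| ^ β)) ∂μ

variable {E : Type*} [MeasurableSpace E] {μ : Measure E} {α β c p : ℝ}

lemma abs_rpow_le_mul_exp (hβ : 0 < β) (hc : 0 < c) (hp : 0 < p) (x : ℝ) :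
    |x| ^ p ≤ (p / (β * c)) ^ (p / β) * Real.exp (c * |x| ^ β) := by
  have hfactor : |x| ^ p = (p / (β * c)) ^ (p / β) * (β * c * |x| ^ β / p) ^ (p / β) := by
    rw [← Real.mul_rpow (by positivity) (by positivity),
      show p / (β * c) * (β * c * |x| ^ β / p) = |x| ^ β by field_simp,
      ← Real.rpow_mul (abs_nonneg x), mul_div_cancel₀ _ hβ.ne']
  have hexp : (β * c * |x| ^ β / p) ^ (p / β) ≤ Real.exp (c * |x| ^ β) := by
    have hle : β * c * |x| ^ β / p ≤ Real.exp (β * c * |x| ^ β / p) := by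
      linarith [Real.add_one_le_exp (β * c * |x| ^ β / p)]
    refine (Real.rpow_le_rpow (by positivity) hle (by positivity)).trans_eq ?_
    rw [← Real.exp_mul]
    congr 1
    field_simp
  rw [hfactor]
  gcongr

lemma eLpNorm_le_expMoment {f : E → ℝ} (hβ : 0 < β) (hc : 0 < c) (hp : 1 ≤ p) :
    eLpNorm f (ENNReal.ofReal p) μ ≤
      ENNReal.ofReal ((p / (β * c)) ^ (1 / β)) * (1 + expMoment β f μ c) := by
  have hp0 : 0 < p := zero_lt_one.trans_le hp
  rw [eLpNorm_eq_lintegral_rpow_enorm_toReal (by simpa using hp0) ENNReal.ofReal_ne_top,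
    ENNReal.toReal_ofReal hp0.le]
  have hmoment : ∫⁻ x, ‖f x‖ₑ ^ p ∂μ ≤
      ENNReal.ofReal ((p / (β * c)) ^ (p / β)) * expMoment β f μ c := by
    rw [expMoment, ← lintegral_const_mul' _ _ ENNReal.ofReal_ne_top]
    refine lintegral_mono fun x => ?_
    rw [← ENNReal.ofReal_mul (by positivity), Real.enorm_eq_ofReal_abs,
      ENNReal.ofReal_rpow_of_nonneg (abs_nonneg _) hp0.le]
    exact ENNReal.ofReal_le_ofReal (abs_rpow_le_mul_exp hβ hc hp0 _)
  have hroot : expMoment β f μ c ^ (1 / p) ≤ 1 + expMoment β f μ c :=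
    calc expMoment β f μ c ^ (1 / p)
        ≤ (1 + expMoment β f μ c) ^ (1 / p) := by gcongr; exact le_add_self
      _ ≤ (1 + expMoment β f μ c) ^ (1 : ℝ) :=
        ENNReal.rpow_le_rpow_of_exponent_le le_self_add ((div_le_one hp0).2 hp)
      _ = 1 + expMoment β f μ c := ENNReal.rpow_one _
  grw [hmoment, ENNReal.mul_rpow_of_nonneg _ _ (by positivity), hroot,
    ENNReal.ofReal_rpow_of_nonneg (by positivity) (by positivity), ← Real.rpow_mul (by positivity)]
  rw [div_mul_div_comm, mul_one, mul_comm β p, div_mul_cancel_left₀ hp0.ne', one_div]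

lemma expOrliczNorm_le_expMoment {f : ℝ → ℝ} {s : Set ℝ} (hβ : 0 < β) (hc : 0 < c) :
    expOrliczNorm β f s ≤
      ENNReal.ofReal ((β * c) ^ (-(1 / β))) * (1 + expMoment β f (volume.restrict s) c) := by
  refine iSup₂_le fun p hp => ?_
  have hp0 : 0 < p := zero_lt_one.trans_le hp
  grw [eLpNorm_le_expMoment hβ hc hp, ← mul_assoc, ← ENNReal.ofReal_mul (by positivity)]
  rw [Real.div_rpow hp0.le (by positivity), Real.rpow_neg hp0.le, Real.rpow_neg (by positivity),
    ← div_eq_inv_mul, div_div_cancel_left' (by positivity)]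

theorem mem_besovOrliczSpace_of_expMoment {f : ℝ → ℝ} (hα : 0 < α) (hβ : 0 < β) (hc : 0 < c)
    (hf : AEMeasurable f (volume.restrict (Ioo 0 1)))
    (hmoment : expMoment β f (volume.restrict (Ioo 0 1)) c < ∞)
    (hincr : ⨆ n : ℕ, expMoment β (Δ_[(1 / 2) ^ n] f)
      (volume.restrict (shiftDomain ((1 / 2) ^ n))) (c / ((1 / 2) ^ n) ^ (β * α)) < ∞) :
    f ∈ BesovOrliczSpace α β := by
  set B := ⨆ n : ℕ, expMoment β (Δ_[(1 / 2) ^ n] f)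
    (volume.restrict (shiftDomain ((1 / 2) ^ n))) (c / ((1 / 2) ^ n) ^ (β * α))
  refine mem_besovOrliczSpace_of_dyadic (A := ENNReal.ofReal ((β * c) ^ (-(1 / β))) * (1 + B)) hα hf
    ?_ (by finiteness) fun n => ?_
  · exact (expOrliczNorm_le_expMoment hβ hc).trans_lt (by finiteness)
  set d : ℝ := (1 / 2) ^ n
  have hd0 : 0 < d := by positivity
  have hscale : (β * (c / d ^ (β * α))) ^ (-(1 / β)) = (β * c) ^ (-(1 / β)) * d ^ α := by
    rw [← mul_div_assoc, Real.div_rpow (by positivity) (by positivity), ← Real.rpow_mul hd0.le,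
      div_eq_mul_inv, ← Real.rpow_neg hd0.le]
    congr 2
    field_simp
  calc incrementNorm β f d
      ≤ ENNReal.ofReal ((β * c) ^ (-(1 / β)) * d ^ α) * (1 + expMoment β (Δ_[d] f)
          (volume.restrict (shiftDomain d)) (c / d ^ (β * α))) := by
        rw [← hscale]
        exact expOrliczNorm_le_expMoment hβ (by positivity)
    _ ≤ ENNReal.ofReal ((β * c) ^ (-(1 / β)) * d ^ α) * (1 + B) := by
        gcongr
        exact le_iSup (fun n : ℕ => expMoment β (Δ_[(1 / 2) ^ n] f)
          (volume.restrict (shiftDomain ((1 / 2) ^ n))) (c / ((1 / 2) ^ n) ^ (β * α))) n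
    _ = ENNReal.ofReal ((β * c) ^ (-(1 / β))) * (1 + B) * ENNReal.ofReal (d ^ α) := by
        rw [ENNReal.ofReal_mul (by positivity)]
        ring

end ExpMoment

section UpperVariance

variable {Ω E : Type*} [MeasurableSpace Ω] [MeasurableSpace E] {P : Measure Ω} {μ : Measure E}
  {φ : E → Ω → ℝ≥0∞}

lemma tsub_sq_add_two_mul_le_sq_add_sq (x m : ℝ≥0∞) :
    (x - m) ^ 2 + 2 * m * x ≤ x ^ 2 + m ^ 2 := by
  rcases le_total x m with h | h
  · obtain ⟨d, rfl⟩ := exists_add_of_le h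
    calc (x - (x + d)) ^ 2 + 2 * (x + d) * x = 2 * (x + d) * x := by
          rw [tsub_eq_zero_of_le h, zero_pow two_ne_zero, zero_add]
      _ ≤ 2 * (x + d) * x + d ^ 2 := le_self_add
      _ = x ^ 2 + (x + d) ^ 2 := by ring
  · obtain ⟨d, rfl⟩ := exists_add_of_le h
    calc (m + d - m) ^ 2 + 2 * m * (m + d) ≤ d ^ 2 + 2 * m * (m + d) := by
          gcongr
          exact add_tsub_le_left
      _ = (m + d) ^ 2 + m ^ 2 := by ring

lemma lintegral_tsub_lintegral_sq_add_sq_le [IsProbabilityMeasure P] {G : Ω → ℝ≥0∞}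
    (hG : AEMeasurable G P) (hfin : ∫⁻ ω, G ω ∂P ≠ ∞) :
    ∫⁻ ω, (G ω - ∫⁻ ω', G ω' ∂P) ^ 2 ∂P + (∫⁻ ω, G ω ∂P) ^ 2 ≤ ∫⁻ ω, G ω ^ 2 ∂P := by
  set m := ∫⁻ ω, G ω ∂P
  refine (ENNReal.add_le_add_iff_right (a := m ^ 2) (by finiteness)).1 ?_
  calc ∫⁻ ω, (G ω - m) ^ 2 ∂P + m ^ 2 + m ^ 2
      = ∫⁻ ω, ((G ω - m) ^ 2 + 2 * m * G ω) ∂P := by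
        rw [lintegral_add_right' _ (hG.const_mul _), lintegral_const_mul'' _ hG]
        ring
    _ ≤ ∫⁻ ω, (G ω ^ 2 + m ^ 2) ∂P :=
        lintegral_mono fun ω => tsub_sq_add_two_mul_le_sq_add_sq _ _
    _ = ∫⁻ ω, G ω ^ 2 ∂P + m ^ 2 := by
        rw [lintegral_add_right _ measurable_const, lintegral_const, measure_univ, mul_one]

lemma lintegral_lintegral_sq [SFinite P] [SFinite μ]
    (hφ : AEMeasurable (Function.uncurry φ) (μ.prod P)) :
    ∫⁻ ω, (∫⁻ s, φ s ω ∂μ) ^ 2 ∂P = ∫⁻ s, ∫⁻ t, ∫⁻ ω, φ s ω * φ t ω ∂P ∂μ ∂μ := by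
  have hmul : AEMeasurable (fun x : (E × E) × Ω => φ x.1.1 x.2 * φ x.1.2 x.2)
      ((μ.prod μ).prod P) :=
    (hφ.comp_quasiMeasurePreserving
      (QuasiMeasurePreserving.prodMap Measure.quasiMeasurePreserving_fst (.id P))).mul
    (hφ.comp_quasiMeasurePreserving
      (QuasiMeasurePreserving.prodMap Measure.quasiMeasurePreserving_snd (.id P)))
  have hsection : ∀ᵐ ω ∂P, AEMeasurable (fun s => φ s ω) μ := by
    filter_upwards [hφ.prod_swap.aestronglyMeasurable.prodMk_left] with ω hω using hω.aemeasurable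
  calc ∫⁻ ω, (∫⁻ s, φ s ω ∂μ) ^ 2 ∂P
      = ∫⁻ ω, ∫⁻ q, φ q.1 ω * φ q.2 ω ∂(μ.prod μ) ∂P := by
        refine lintegral_congr_ae (hsection.mono fun ω hω => ?_)
        beta_reduce
        rw [sq, ← lintegral_prod_mul hω hω]
    _ = ∫⁻ q, ∫⁻ ω, φ q.1 ω * φ q.2 ω ∂P ∂(μ.prod μ) :=
        (lintegral_lintegral_swap hmul).symm
    _ = ∫⁻ s, ∫⁻ t, ∫⁻ ω, φ s ω * φ t ω ∂P ∂μ ∂μ :=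
        lintegral_prod _ hmul.lintegral_prod_right'

lemma lintegral_tsub_sq_le_of_decorrelation [IsProbabilityMeasure P] [SFinite μ]
    (hφ : AEMeasurable (Function.uncurry φ) (μ.prod P)) {ρ : E → E → ℝ≥0∞}
    (hρ : ∀ᵐ s ∂μ, ∀ᵐ t ∂μ, ∫⁻ ω, φ s ω * φ t ω ∂P ≤
      (∫⁻ ω, φ s ω ∂P) * (∫⁻ ω, φ t ω ∂P) + ρ s t)
    (hfin : ∫⁻ ω, ∫⁻ s, φ s ω ∂μ ∂P ≠ ∞) :
    ∫⁻ ω, (∫⁻ s, φ s ω ∂μ - ∫⁻ ω', ∫⁻ s, φ s ω' ∂μ ∂P) ^ 2 ∂P ≤ ∫⁻ s, ∫⁻ t, ρ s t ∂μ ∂μ := by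
  have hG : AEMeasurable (fun ω => ∫⁻ s, φ s ω ∂μ) P := hφ.lintegral_prod_left'
  have hmean : AEMeasurable (fun s => ∫⁻ ω, φ s ω ∂P) μ := hφ.lintegral_prod_right'
  have hswap : ∫⁻ s, ∫⁻ ω, φ s ω ∂P ∂μ = ∫⁻ ω, ∫⁻ s, φ s ω ∂μ ∂P := lintegral_lintegral_swap hφ
  have hsecond : ∫⁻ ω, (∫⁻ s, φ s ω ∂μ) ^ 2 ∂P ≤
      (∫⁻ ω, ∫⁻ s, φ s ω ∂μ ∂P) ^ 2 + ∫⁻ s, ∫⁻ t, ρ s t ∂μ ∂μ :=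
    calc ∫⁻ ω, (∫⁻ s, φ s ω ∂μ) ^ 2 ∂P
        = ∫⁻ s, ∫⁻ t, ∫⁻ ω, φ s ω * φ t ω ∂P ∂μ ∂μ := lintegral_lintegral_sq hφ
      _ ≤ ∫⁻ s, ∫⁻ t, ((∫⁻ ω, φ s ω ∂P) * (∫⁻ ω, φ t ω ∂P) + ρ s t) ∂μ ∂μ :=
          lintegral_mono_ae (hρ.mono fun s hs => lintegral_mono_ae hs)
      _ = ∫⁻ s, ((∫⁻ ω, φ s ω ∂P) * (∫⁻ ω, ∫⁻ s, φ s ω ∂μ ∂P) + ∫⁻ t, ρ s t ∂μ) ∂μ := by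
          refine lintegral_congr fun s => ?_
          rw [lintegral_add_left' (hmean.const_mul _), lintegral_const_mul'' _ hmean, hswap]
      _ = (∫⁻ ω, ∫⁻ s, φ s ω ∂μ ∂P) ^ 2 + ∫⁻ s, ∫⁻ t, ρ s t ∂μ ∂μ := by
          rw [lintegral_add_left' (hmean.mul_const _), lintegral_mul_const'' _ hmean, hswap, sq]
  refine (ENNReal.add_le_add_iff_left (a := (∫⁻ ω, ∫⁻ s, φ s ω ∂μ ∂P) ^ 2) (by finiteness)).1 ?_
  rw [add_comm]
  exact (lintegral_tsub_lintegral_sq_add_sq_le hG hfin).trans hsecond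

lemma ae_iSup_lt_top_of_tsum_lintegral_tsub_sq {G : ℕ → Ω → ℝ≥0∞}
    (hG : ∀ n, AEMeasurable (G n) P) {m : ℕ → ℝ≥0∞} {κ : ℝ≥0∞} (hκ : κ ≠ ∞) (hm : ∀ n, m n ≤ κ)
    (hsum : ∑' n, ∫⁻ ω, (G n ω - m n) ^ 2 ∂P ≠ ∞) :
    ∀ᵐ ω ∂P, ⨆ n, G n ω < ∞ := by
  have hmeas (n : ℕ) : AEMeasurable (fun ω => (G n ω - m n) ^ 2) P :=
    ((hG n).sub aemeasurable_const).pow_const 2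
  rw [← lintegral_tsum hmeas] at hsum
  filter_upwards [ae_lt_top' (AEMeasurable.tsum hmeas) hsum] with ω hω
  have hexcess (n : ℕ) : G n ω - m n ≤ 1 + ∑' n, (G n ω - m n) ^ 2 := by
    rcases le_total (G n ω - m n) 1 with hle | hle
    · exact hle.trans le_self_add
    · exact (le_self_pow₀ hle two_ne_zero).trans ((ENNReal.le_tsum n).trans le_add_self)
  refine (iSup_le fun n => ?_).trans_lt
    (show 1 + ∑' n, (G n ω - m n) ^ 2 + κ < ∞ by finiteness)
  exact le_tsub_add.trans (add_le_add (hexcess n) (hm n))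

end UpperVariance

section Gaussian

variable {Ω : Type*} [MeasurableSpace Ω] {P : Measure Ω} {X Y : Ω → ℝ} {c K : ℝ}

lemma expMoment_two {E : Type*} [MeasurableSpace E] (f : E → ℝ) (μ : Measure E) (c : ℝ) :
    expMoment 2 f μ c = ∫⁻ x, ENNReal.ofReal (Real.exp (c * f x ^ 2)) ∂μ := by
  simp only [expMoment, Real.rpow_two, sq_abs]

lemma expMoment_mono {E : Type*} [MeasurableSpace E] {f : E → ℝ} {μ : Measure E} {β c' : ℝ}
    (hcc' : c ≤ c') : expMoment β f μ c ≤ expMoment β f μ c' := by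
  refine lintegral_mono fun x => ENNReal.ofReal_le_ofReal (Real.exp_le_exp.2 ?_)
  gcongr

lemma lintegral_exp_eq_of_hasGaussianLaw (hX : HasGaussianLaw X P) (hX0 : P[X] = 0) :
    ∫⁻ ω, ENNReal.ofReal (Real.exp (X ω)) ∂P = ENNReal.ofReal (Real.exp (Var[X; P] / 2)) := by
  have hlaw := hX.map_eq_gaussianReal
  rw [hX0] at hlaw
  have hmgf : ∫ ω, Real.exp (X ω) ∂P = Real.exp (Var[X; P] / 2) := by
    simpa [mgf, Real.coe_toNNReal _ (variance_nonneg X P)] using mgf_gaussianReal hlaw 1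
  rw [← hmgf, ofReal_integral_eq_lintegral_ofReal
    (.of_integral_ne_zero (hmgf ▸ (Real.exp_pos _).ne')) (ae_of_all _ fun _ => (Real.exp_pos _).le)]

-- The Hubbard–Stratonovich transform: it makes `exp (c x ^ 2)` exponential-linear in `x`.
lemma ofReal_exp_sq_eq_lintegral_gaussianReal (hc : 0 ≤ c) (x : ℝ) :
    ENNReal.ofReal (Real.exp (c * x ^ 2)) =
      ∫⁻ z, ENNReal.ofReal (Real.exp (√(2 * c) * z * x)) ∂gaussianReal 0 1 := by
  have hlaw : HasGaussianLaw (fun z : ℝ => √(2 * c) * z * x) (gaussianReal 0 1) := by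
    simpa only [smul_eq_mul, id, mul_right_comm] using
      (IsGaussian.hasGaussianLaw_id (μ := gaussianReal 0 1)).fun_smul (√(2 * c) * x)
  have hmean : ∫ z, √(2 * c) * z * x ∂gaussianReal 0 1 = 0 := by
    rw [integral_mul_const, integral_const_mul, integral_id_gaussianReal, mul_zero, zero_mul]
  rw [lintegral_exp_eq_of_hasGaussianLaw hlaw hmean]
  congr 2
  rw [variance_mul_const, variance_const_mul, variance_fun_id_gaussianReal,
    Real.sq_sqrt (by positivity)]
  push_cast
  ring

lemma expMoment_two_of_hasGaussianLaw (hX : HasGaussianLaw X P) (hX0 : P[X] = 0) (c : ℝ) :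
    expMoment 2 X P c = expMoment 2 id (gaussianReal 0 1) (c * Var[X; P]) := by
  have hlaw : P.map X = (gaussianReal 0 1).map (√Var[X; P] * ·) := by
    rw [hX.map_eq_gaussianReal, hX0, gaussianReal_map_const_mul, mul_zero, mul_one]
    congr 1
    ext
    simp [Real.sq_sqrt, variance_nonneg]
  rw [expMoment_two, expMoment_two,
    ← lintegral_map' (f := fun x => ENNReal.ofReal (Real.exp (c * x ^ 2))) (by fun_prop)
      hX.aemeasurable, hlaw, lintegral_map (by fun_prop) (by fun_prop)]
  simp only [mul_pow, Real.sq_sqrt (variance_nonneg X P), id, mul_assoc]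

lemma expMoment_two_le_of_variance_le (hX : HasGaussianLaw X P) (hX0 : P[X] = 0) (hc : 0 ≤ c)
    (hK : Var[X; P] ≤ K) : expMoment 2 X P c ≤ expMoment 2 id (gaussianReal 0 1) (c * K) := by
  rw [expMoment_two_of_hasGaussianLaw hX hX0]
  exact expMoment_mono (by gcongr)

lemma exists_expMoment_two_gaussianReal_lt_top :
    ∃ c > 0, expMoment 2 id (gaussianReal 0 1) c < ∞ := by
  obtain ⟨c, hc, hint⟩ := IsGaussian.exists_integrable_exp_sq (gaussianReal 0 1)
  simp only [Real.norm_eq_abs, sq_abs] at hint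
  exact ⟨c, hc, expMoment_two id (gaussianReal 0 1) c ▸
    (hasFiniteIntegral_iff_ofReal (ae_of_all _ fun _ => (Real.exp_pos _).le)).1 hint.2⟩

lemma abs_covariance_le_of_variance_le [IsFiniteMeasure P] (hX : MemLp X 2 P)
    (hY : MemLp Y 2 P) (hXK : Var[X; P] ≤ K) (hYK : Var[Y; P] ≤ K) : |cov[X, Y; P]| ≤ K := by
  have hadd := variance_nonneg (X + Y) P
  have hsub := variance_nonneg (X - Y) P
  rw [variance_add hX hY] at hadd
  rw [variance_sub hX hY] at hsub
  exact abs_le.2 ⟨by linarith, by linarith⟩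

end Gaussian

section Decorrelation

variable {Ω : Type*} [MeasurableSpace Ω] {P : Measure Ω} {X Y : Ω → ℝ} {c K : ℝ}

lemma exp_mul_le_one_add_mul_exp {θ x y : ℝ} (hθ0 : 0 ≤ θ) (hθ1 : θ ≤ 1) (hyx : y ≤ θ * x) :
    Real.exp y ≤ 1 + θ * Real.exp x := by
  have hconv := convexOn_exp.2 (mem_univ 0) (mem_univ x) (sub_nonneg.2 hθ1) hθ0 (by ring)
  simp only [smul_eq_mul, mul_zero, zero_add, Real.exp_zero, mul_one] at hconv
  linarith [Real.exp_le_exp.2 hyx]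

lemma exp_quadratic_form_le {a b r : ℝ} (hK : 0 < K) (hc : 0 ≤ c) (ha : a ≤ K) (hb : b ≤ K)
    (hr : |r| ≤ K) (z w : ℝ) :
    Real.exp (c * (a * z ^ 2 + 2 * r * z * w + b * w ^ 2)) ≤
      Real.exp (c * a * z ^ 2) * Real.exp (c * b * w ^ 2) +
        |r| / K * (Real.exp (2 * c * K * z ^ 2) * Real.exp (2 * c * K * w ^ 2)) := by
  set x : ℝ := c * K * (z ^ 2 + w ^ 2) with hx
  have hcross : 2 * c * r * z * w ≤ |r| / K * x :=
    calc 2 * c * r * z * w = c * (r * (2 * z * w)) := by ring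
      _ ≤ c * (|r| * |2 * z * w|) := by
        rw [← abs_mul]
        gcongr
        exact le_abs_self _
      _ ≤ c * (|r| * (z ^ 2 + w ^ 2)) := by
        gcongr
        rw [abs_le]
        constructor <;> nlinarith [sq_nonneg (z + w), sq_nonneg (z - w)]
      _ = |r| / K * x := by rw [hx]; field_simp
  have hdiag : Real.exp (c * a * z ^ 2) * Real.exp (c * b * w ^ 2) ≤ Real.exp x := by
    rw [← Real.exp_add, Real.exp_le_exp, hx, mul_add]
    gcongr
  calc Real.exp (c * (a * z ^ 2 + 2 * r * z * w + b * w ^ 2))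
      = Real.exp (c * a * z ^ 2) * Real.exp (c * b * w ^ 2) * Real.exp (2 * c * r * z * w) := by
        rw [← Real.exp_add, ← Real.exp_add]; ring_nf
    _ ≤ Real.exp (c * a * z ^ 2) * Real.exp (c * b * w ^ 2) * (1 + |r| / K * Real.exp x) := by
        gcongr
        exact exp_mul_le_one_add_mul_exp (by positivity) ((div_le_one hK).2 hr) hcross
    _ = Real.exp (c * a * z ^ 2) * Real.exp (c * b * w ^ 2) +
        |r| / K * (Real.exp (c * a * z ^ 2) * Real.exp (c * b * w ^ 2) * Real.exp x) := by ring
    _ ≤ Real.exp (c * a * z ^ 2) * Real.exp (c * b * w ^ 2) +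
        |r| / K * (Real.exp x * Real.exp x) := by gcongr
    _ = _ := by rw [← Real.exp_add x, ← Real.exp_add (2 * c * K * z ^ 2), hx]; ring_nf

lemma lintegral_exp_linear_of_hasGaussianLaw (hXY : HasGaussianLaw (fun ω => (X ω, Y ω)) P)
    (hX0 : P[X] = 0) (hY0 : P[Y] = 0) (z w : ℝ) :
    ∫⁻ ω, ENNReal.ofReal (Real.exp (z * X ω + w * Y ω)) ∂P =
      ENNReal.ofReal (Real.exp
        ((Var[X; P] * z ^ 2 + 2 * cov[X, Y; P] * z * w + Var[Y; P] * w ^ 2) / 2)) := by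
  have := hXY.isProbabilityMeasure
  have hX := hXY.fst
  have hY := hXY.snd
  have hlaw : HasGaussianLaw (fun ω => z * X ω + w * Y ω) P :=
    hXY.map_fun (z • ContinuousLinearMap.fst ℝ ℝ ℝ + w • ContinuousLinearMap.snd ℝ ℝ ℝ)
  have hmean : ∫ ω, z * X ω + w * Y ω ∂P = 0 := by
    rw [integral_add (hX.integrable.const_mul z) (hY.integrable.const_mul w), integral_const_mul,
      integral_const_mul, hX0, hY0, mul_zero, mul_zero, add_zero]
  rw [lintegral_exp_eq_of_hasGaussianLaw hlaw hmean,
    variance_fun_add (hX.memLp_two.const_mul z) (hY.memLp_two.const_mul w), variance_const_mul,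
    variance_const_mul, covariance_const_mul_left, covariance_const_mul_right]
  ring_nf

lemma lintegral_exp_sq_mul_exp_sq_of_hasGaussianLaw
    (hXY : HasGaussianLaw (fun ω => (X ω, Y ω)) P) (hX0 : P[X] = 0) (hY0 : P[Y] = 0)
    (hc : 0 ≤ c) :
    ∫⁻ ω, ENNReal.ofReal (Real.exp (c * X ω ^ 2)) * ENNReal.ofReal (Real.exp (c * Y ω ^ 2)) ∂P =
      ∫⁻ q : ℝ × ℝ, ENNReal.ofReal (Real.exp (c * (Var[X; P] * q.1 ^ 2 +
        2 * cov[X, Y; P] * q.1 * q.2 + Var[Y; P] * q.2 ^ 2)))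
        ∂(gaussianReal 0 1).prod (gaussianReal 0 1) := by
  have := hXY.isProbabilityMeasure
  have hX : AEMeasurable X P := hXY.fst.aemeasurable
  have hY : AEMeasurable Y P := hXY.snd.aemeasurable
  have hprod (ω : Ω) :
      ENNReal.ofReal (Real.exp (c * X ω ^ 2)) * ENNReal.ofReal (Real.exp (c * Y ω ^ 2)) =
      ∫⁻ q, ENNReal.ofReal (Real.exp (√(2 * c) * q.1 * X ω + √(2 * c) * q.2 * Y ω))
        ∂(gaussianReal 0 1).prod (gaussianReal 0 1) := by
    rw [ofReal_exp_sq_eq_lintegral_gaussianReal hc, ofReal_exp_sq_eq_lintegral_gaussianReal hc,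
      ← lintegral_prod_mul (by fun_prop) (by fun_prop)]
    simp only [Real.exp_add, ENNReal.ofReal_mul (Real.exp_pos _).le]
  have hmeas : AEMeasurable (Function.uncurry fun (ω : Ω) (q : ℝ × ℝ) => ENNReal.ofReal
      (Real.exp (√(2 * c) * q.1 * X ω + √(2 * c) * q.2 * Y ω)))
      (P.prod ((gaussianReal 0 1).prod (gaussianReal 0 1))) := by
    have := hX.comp_fst (ν := (gaussianReal 0 1).prod (gaussianReal 0 1))
    have := hY.comp_fst (ν := (gaussianReal 0 1).prod (gaussianReal 0 1))
    simp only [Function.uncurry_def]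
    fun_prop
  simp only [hprod]
  rw [lintegral_lintegral_swap hmeas]
  refine lintegral_congr fun q => ?_
  rw [lintegral_exp_linear_of_hasGaussianLaw hXY hX0 hY0]
  congr 2
  linear_combination (Var[X; P] * q.1 ^ 2 + 2 * cov[X, Y; P] * q.1 * q.2 + Var[Y; P] * q.2 ^ 2) / 2
    * Real.sq_sqrt (by positivity : 0 ≤ 2 * c)

theorem lintegral_exp_sq_mul_exp_sq_le (hXY : HasGaussianLaw (fun ω => (X ω, Y ω)) P)
    (hX0 : P[X] = 0) (hY0 : P[Y] = 0) (hK : 0 < K) (hc : 0 ≤ c) (hXK : Var[X; P] ≤ K)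
    (hYK : Var[Y; P] ≤ K) :
    ∫⁻ ω, ENNReal.ofReal (Real.exp (c * X ω ^ 2)) * ENNReal.ofReal (Real.exp (c * Y ω ^ 2)) ∂P ≤
      expMoment 2 X P c * expMoment 2 Y P c +
        ENNReal.ofReal (|cov[X, Y; P]| / K) *
          expMoment 2 id (gaussianReal 0 1) (2 * c * K) ^ 2 := by
  have := hXY.isProbabilityMeasure
  have hr : |cov[X, Y; P]| ≤ K :=
    abs_covariance_le_of_variance_le hXY.fst.memLp_two hXY.snd.memLp_two hXK hYK
  rw [expMoment_two_of_hasGaussianLaw hXY.fst hX0, expMoment_two_of_hasGaussianLaw hXY.snd hY0,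
    lintegral_exp_sq_mul_exp_sq_of_hasGaussianLaw hXY hX0 hY0 hc]
  simp only [expMoment_two, id, sq (lintegral _ _)]
  rw [← lintegral_prod_mul (by fun_prop) (by fun_prop),
    ← lintegral_prod_mul (by fun_prop) (by fun_prop), ← lintegral_const_mul _ (by fun_prop),
    ← lintegral_add_left (by fun_prop)]
  refine lintegral_mono fun q => ?_
  rw [← ENNReal.ofReal_mul (by positivity), ← ENNReal.ofReal_mul (by positivity),
    ← ENNReal.ofReal_mul (by positivity), ← ENNReal.ofReal_add (by positivity) (by positivity)]
  exact ENNReal.ofReal_le_ofReal (exp_quadratic_form_le hK hc hXK hYK hr _ _)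

end Decorrelation

section GaussianFamily

variable {Ω E : Type*} [MeasurableSpace Ω] [MeasurableSpace E] {P : Measure Ω} {μ : Measure E}
  {Y : E → Ω → ℝ} {c K : ℝ}

lemma aemeasurable_exp_sq (hmeas : AEMeasurable (Function.uncurry Y) (μ.prod P)) (c : ℝ) :
    AEMeasurable (Function.uncurry fun s ω => ENNReal.ofReal (Real.exp (c * Y s ω ^ 2)))
      (μ.prod P) :=
  (Real.measurable_exp.comp_aemeasurable ((hmeas.pow_const 2).const_mul c)).ennreal_ofReal

lemma aemeasurable_expMoment_two [SFinite P] [SFinite μ]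
    (hmeas : AEMeasurable (Function.uncurry Y) (μ.prod P)) (c : ℝ) :
    AEMeasurable (fun ω => expMoment 2 (fun s => Y s ω) μ c) P := by
  simp only [expMoment_two]
  exact (aemeasurable_exp_sq hmeas c).lintegral_prod_left'

lemma lintegral_expMoment_two_le [SFinite μ] (hY : IsGaussianProcess Y P)
    (hY0 : ∀ s, P[Y s] = 0) (hmeas : AEMeasurable (Function.uncurry Y) (μ.prod P)) (hc : 0 ≤ c)
    (hK : ∀ᵐ s ∂μ, Var[Y s; P] ≤ K) :
    ∫⁻ ω, expMoment 2 (fun s => Y s ω) μ c ∂P ≤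
      expMoment 2 id (gaussianReal 0 1) (c * K) * μ univ := by
  have := hY.isProbabilityMeasure
  simp only [expMoment_two _ μ]
  rw [← lintegral_lintegral_swap (aemeasurable_exp_sq hmeas c), ← lintegral_const]
  refine lintegral_mono_ae (hK.mono fun s hs => ?_)
  rw [← expMoment_two]
  exact expMoment_two_le_of_variance_le (hY.hasGaussianLaw_eval s) (hY0 s) hc hs

theorem lintegral_expMoment_two_tsub_sq_le [IsFiniteMeasure μ] (hY : IsGaussianProcess Y P)
    (hY0 : ∀ s, P[Y s] = 0) (hmeas : AEMeasurable (Function.uncurry Y) (μ.prod P)) (hc : 0 ≤ c)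
    (hK0 : 0 < K) (hK : ∀ᵐ s ∂μ, Var[Y s; P] ≤ K)
    (hfin : expMoment 2 id (gaussianReal 0 1) (2 * c * K) ≠ ∞) :
    ∫⁻ ω, (expMoment 2 (fun s => Y s ω) μ c -
        ∫⁻ ω', expMoment 2 (fun s => Y s ω') μ c ∂P) ^ 2 ∂P ≤
      (∫⁻ s, ∫⁻ t, ENNReal.ofReal (|cov[Y s, Y t; P]| / K) ∂μ ∂μ) *
        expMoment 2 id (gaussianReal 0 1) (2 * c * K) ^ 2 := by
  have := hY.isProbabilityMeasure
  have hmean : ∫⁻ ω, expMoment 2 (fun s => Y s ω) μ c ∂P ≠ ∞ := by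
    refine ne_top_of_le_ne_top ?_ (lintegral_expMoment_two_le hY hY0 hmeas hc hK)
    exact ENNReal.mul_ne_top
      (ne_top_of_le_ne_top hfin (expMoment_mono (by nlinarith [mul_nonneg hc hK0.le])))
      (measure_ne_top μ univ)
  have hκ : expMoment 2 id (gaussianReal 0 1) (2 * c * K) ^ 2 ≠ ∞ := by finiteness
  simp only [← lintegral_mul_const' _ _ hκ]
  simp only [expMoment_two _ μ] at hmean ⊢
  refine lintegral_tsub_sq_le_of_decorrelation (aemeasurable_exp_sq hmeas c) ?_ hmean
  filter_upwards [hK] with s hs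
  filter_upwards [hK] with t ht
  simpa only [expMoment_two _ P] using lintegral_exp_sq_mul_exp_sq_le
    (hY.hasGaussianLaw_prodMk) (hY0 s) (hY0 t) hK0 hc hs ht

end GaussianFamily

section GaussianCriterion

variable {Ω E : Type*} [MeasurableSpace Ω] [MeasurableSpace E] {P : Measure Ω}

lemma ae_expMoment_two_lt_top {μ : Measure E} [IsFiniteMeasure μ] {Y : E → Ω → ℝ} {c K : ℝ}
    (hY : IsGaussianProcess Y P) (hY0 : ∀ s, P[Y s] = 0)
    (hmeas : AEMeasurable (Function.uncurry Y) (μ.prod P)) (hc : 0 ≤ c)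
    (hK : ∀ᵐ s ∂μ, Var[Y s; P] ≤ K)
    (hfin : expMoment 2 id (gaussianReal 0 1) (c * K) ≠ ∞) :
    ∀ᵐ ω ∂P, expMoment 2 (fun s => Y s ω) μ c < ∞ := by
  have := hY.isProbabilityMeasure
  refine ae_lt_top' (aemeasurable_expMoment_two hmeas c) ?_
  exact ne_top_of_le_ne_top (by finiteness) (lintegral_expMoment_two_le hY hY0 hmeas hc hK)

theorem ae_iSup_expMoment_two_lt_top {μ : ℕ → Measure E} {Y : ℕ → E → Ω → ℝ} {c K : ℕ → ℝ}
    {κ : ℝ} (hμ : ∀ n, μ n univ ≤ 1) (hY : ∀ n, IsGaussianProcess (Y n) P)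
    (hY0 : ∀ n s, P[Y n s] = 0)
    (hmeas : ∀ n, AEMeasurable (Function.uncurry (Y n)) ((μ n).prod P)) (hc : ∀ n, 0 ≤ c n)
    (hK0 : ∀ n, 0 < K n) (hK : ∀ n, ∀ᵐ s ∂μ n, Var[Y n s; P] ≤ K n)
    (hκ : ∀ n, 2 * c n * K n ≤ κ) (hfin : expMoment 2 id (gaussianReal 0 1) κ ≠ ∞)
    (hsum : ∑' n, ∫⁻ s, ∫⁻ t, ENNReal.ofReal (|cov[Y n s, Y n t; P]| / K n) ∂μ n ∂μ n ≠ ∞) :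
    ∀ᵐ ω ∂P, ⨆ n, expMoment 2 (fun s => Y n s ω) (μ n) (c n) < ∞ := by
  have := (hY 0).isProbabilityMeasure
  have (n : ℕ) : IsFiniteMeasure (μ n) := ⟨(hμ n).trans_lt ENNReal.one_lt_top⟩
  have hle (n : ℕ) : expMoment 2 id (gaussianReal 0 1) (2 * c n * K n) ≤
      expMoment 2 id (gaussianReal 0 1) κ := expMoment_mono (hκ n)
  refine ae_iSup_lt_top_of_tsum_lintegral_tsub_sq
    (m := fun n => ∫⁻ ω, expMoment 2 (fun s => Y n s ω) (μ n) (c n) ∂P)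
    (fun n => aemeasurable_expMoment_two (hmeas n) (c n)) hfin (fun n => ?_) ?_
  · calc ∫⁻ ω, expMoment 2 (fun s => Y n s ω) (μ n) (c n) ∂P
        ≤ expMoment 2 id (gaussianReal 0 1) (c n * K n) * μ n univ :=
          lintegral_expMoment_two_le (hY n) (hY0 n) (hmeas n) (hc n) (hK n)
      _ ≤ expMoment 2 id (gaussianReal 0 1) (c n * K n) := mul_le_of_le_one_right' (hμ n)
      _ ≤ expMoment 2 id (gaussianReal 0 1) κ :=
          expMoment_mono (by nlinarith [hκ n, mul_nonneg (hc n) (hK0 n).le])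
  · refine ne_top_of_le_ne_top (ENNReal.mul_ne_top hsum (ENNReal.pow_ne_top (n := 2) hfin)) ?_
    rw [← ENNReal.tsum_mul_right]
    refine ENNReal.tsum_le_tsum fun n => ?_
    grw [lintegral_expMoment_two_tsub_sq_le (hY n) (hY0 n) (hmeas n) (hc n) (hK0 n) (hK n)
      (ne_top_of_le_ne_top hfin (hle n)), hle n]

variable {X : ℝ → Ω → ℝ}

lemma isGaussianProcess_fwdDiff (hX : IsGaussianProcess X P) (d : ℝ) :
    IsGaussianProcess (Δ_[d] X) P := by
  classical
  refine hX.of_isGaussianProcess fun s => ⟨{s + d, s},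
    ContinuousLinearMap.proj ⟨s + d, by simp⟩ - ContinuousLinearMap.proj ⟨s, by simp⟩,
    fun ω => ?_⟩
  simp [Finset.restrict, fwdDiff]

lemma integral_fwdDiff_eq_zero (hX : IsGaussianProcess X P) (hX0 : ∀ t, P[X t] = 0) (d s : ℝ) :
    P[Δ_[d] X s] = 0 := by
  simp only [fwdDiff, Pi.sub_apply]
  rw [integral_sub (hX.hasGaussianLaw_eval _).integrable (hX.hasGaussianLaw_eval _).integrable,
    hX0, hX0, sub_zero]

lemma aemeasurable_uncurry_fwdDiff_shiftDomain [SFinite P]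
    (hmeas : AEMeasurable (Function.uncurry X) ((volume.restrict (Ioo 0 1)).prod P)) (d : ℝ) :
    AEMeasurable (Function.uncurry (Δ_[d] X)) ((volume.restrict (shiftDomain d)).prod P) := by
  refine AEMeasurable.sub ?_ ?_
  · exact hmeas.comp_quasiMeasurePreserving (QuasiMeasurePreserving.prodMap
      (quasiMeasurePreserving_add_right_restrict (mapsTo_add_right_shiftDomain d)) (.id P))
  · exact hmeas.mono_measure
      (Measure.prod_mono (Measure.restrict_mono_set _ (shiftDomain_subset_Ioo d)) le_rfl)

theorem ae_mem_besovOrliczSpace_of_isGaussianProcess {H K : ℝ} (hH : 0 < H) (hK : 0 < K)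
    (hX : IsGaussianProcess X P) (hX0 : ∀ t, P[X t] = 0)
    (hmeas : AEMeasurable (Function.uncurry X) ((volume.restrict (Ioo 0 1)).prod P))
    (hvar : ∀ t ∈ Ioo 0 1, Var[X t; P] ≤ K)
    (hincr : ∀ n : ℕ, ∀ s ∈ shiftDomain ((1 / 2) ^ n),
      Var[Δ_[(1 / 2) ^ n] X s; P] ≤ K * ((1 / 2) ^ n) ^ (2 * H))
    (hcov : ∑' n : ℕ, ∫⁻ s in shiftDomain ((1 / 2) ^ n), ∫⁻ t in shiftDomain ((1 / 2) ^ n),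
      ENNReal.ofReal (|cov[Δ_[(1 / 2) ^ n] X s, Δ_[(1 / 2) ^ n] X t; P]| /
        (K * ((1 / 2) ^ n) ^ (2 * H))) ≠ ∞) :
    ∀ᵐ ω ∂P, (fun t => X t ω) ∈ BesovOrliczSpace H 2 := by
  have := hX.isProbabilityMeasure
  obtain ⟨κ, hκ, hfin⟩ := exists_expMoment_two_gaussianReal_lt_top
  have hc : 0 < κ / (2 * K) := by positivity
  have hpath : ∀ᵐ ω ∂P, AEMeasurable (fun t => X t ω) (volume.restrict (Ioo 0 1)) := by
    filter_upwards [hmeas.prod_swap.aestronglyMeasurable.prodMk_left] with ω hω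
      using hω.aemeasurable
  have hmoment := ae_expMoment_two_lt_top hX hX0 hmeas hc.le
    (ae_restrict_of_forall_mem measurableSet_Ioo hvar)
    (ne_top_of_le_ne_top hfin.ne (expMoment_mono (by field_simp; linarith)))
  have hmoments := ae_iSup_expMoment_two_lt_top
    (μ := fun n : ℕ => volume.restrict (shiftDomain ((1 / 2) ^ n)))
    (c := fun n : ℕ => κ / (2 * K) / ((1 / 2) ^ n) ^ (2 * H))
    (fun n => by simpa using volume_shiftDomain_le_one _)
    (fun n => isGaussianProcess_fwdDiff hX _)
    (fun n => integral_fwdDiff_eq_zero hX hX0 _)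
    (fun n => aemeasurable_uncurry_fwdDiff_shiftDomain hmeas _)
    (fun n => by positivity) (fun n => by positivity)
    (fun n => ae_restrict_of_forall_mem (measurableSet_shiftDomain _) (hincr n))
    (fun n => by field_simp; rfl) hfin.ne hcov
  filter_upwards [hpath, hmoment, hmoments] with ω hω hmoment hmoments
  exact mem_besovOrliczSpace_of_expMoment hH two_pos hc hω hmoment hmoments

end GaussianCriterion

section SecondDifference

variable {a d r u : ℝ}

/-- The symmetric second difference of `g` at `u` with step `d`, in terms of which the covariances
of increments are written. -/
def symmSecondDiff (g : ℝ → ℝ) (d u : ℝ) : ℝ :=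
  g (u + d) + g (u - d) - 2 * g u

lemma exists_symmSecondDiff_eq_sq_mul {g g' g'' : ℝ → ℝ} (hd : 0 < d)
    (hg : ∀ x ∈ Icc (u - d) (u + d), HasDerivAt g (g' x) x)
    (hg' : ∀ x ∈ Icc (u - d) (u + d), HasDerivAt g' (g'' x) x) :
    ∃ y ∈ Ioo (u - d) (u + d), symmSecondDiff g d u = d ^ 2 * g'' y := by
  have hdiff (x : ℝ) (hx : x ∈ Icc (u - d) u) :
      HasDerivAt (fun x => g (x + d) - g x) (g' (x + d) - g' x) x :=
    ((hg (x + d) ⟨by linarith [hx.1], by linarith [hx.2]⟩).comp_add_const x d).sub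
      (hg x ⟨hx.1, by linarith [hx.2]⟩)
  obtain ⟨x, hx, hslope⟩ := exists_hasDerivAt_eq_slope (fun x => g (x + d) - g x) _
    (sub_lt_self u hd) (fun x hx => (hdiff x hx).continuousAt.continuousWithinAt)
    (fun x hx => hdiff x (Ioo_subset_Icc_self hx))
  have hsub : Icc x (x + d) ⊆ Icc (u - d) (u + d) :=
    Icc_subset_Icc hx.1.le (by linarith [hx.2])
  obtain ⟨y, hy, hslope'⟩ := exists_hasDerivAt_eq_slope g' g'' (lt_add_of_pos_right x hd)
    (fun y hy => (hg' y (hsub hy)).continuousAt.continuousWithinAt)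
    (fun y hy => hg' y (hsub (Ioo_subset_Icc_self hy)))
  refine ⟨y, ⟨by linarith [hx.1, hy.1], by linarith [hx.2, hy.2]⟩, ?_⟩
  simp only [sub_sub_cancel, sub_add_cancel, add_sub_cancel_left] at hslope hslope'
  rw [eq_div_iff hd.ne'] at hslope hslope'
  rw [symmSecondDiff]
  linear_combination -hslope - d * hslope'

lemma symmSecondDiff_abs_rpow_of_le (hd : 0 ≤ d) (hu : d ≤ |u|) :
    symmSecondDiff (fun x => |x| ^ a) d u = symmSecondDiff (fun x => x ^ a) d |u| := by
  simp only [symmSecondDiff]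
  rcases abs_cases u with ⟨h, hu0⟩ | ⟨h, hu0⟩ <;> rw [h] at hu ⊢
  · rw [abs_of_nonneg (by linarith), abs_of_nonneg (by linarith)]
  · rw [abs_of_nonpos (by linarith), abs_of_nonpos (by linarith)]
    ring_nf

lemma abs_symmSecondDiff_abs_rpow_le (ha0 : 0 ≤ a) (ha2 : a ≤ 2) (hd : 0 < d) (hr : 0 < r)
    (hu : d + r ≤ |u|) :
    |symmSecondDiff (fun x => |x| ^ a) d u| ≤ 2 * d ^ 2 * r ^ (a - 2) := by
  have hpos {x : ℝ} (hx : x ∈ Icc (|u| - d) (|u| + d)) : 0 < x := by linarith [hx.1]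
  obtain ⟨y, hy, heq⟩ := exists_symmSecondDiff_eq_sq_mul hd
    (fun x hx => Real.hasDerivAt_rpow_const (p := a) (.inl (hpos hx).ne'))
    (fun x hx => (Real.hasDerivAt_rpow_const (p := a - 1) (.inl (hpos hx).ne')).const_mul a)
  have hry : r ≤ y := by linarith [hy.1]
  have hcoeff : |a * (a - 1)| ≤ 2 := by rw [abs_le]; constructor <;> nlinarith
  have hrpow : y ^ (a - 2) ≤ r ^ (a - 2) := Real.rpow_le_rpow_of_nonpos hr hry (by linarith)
  have hy0 : 0 ≤ y ^ (a - 2) := Real.rpow_nonneg (hr.le.trans hry) _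
  rw [symmSecondDiff_abs_rpow_of_le hd.le (by linarith), heq, sub_sub, one_add_one_eq_two,
    ← mul_assoc a, abs_mul, abs_mul (a * _), abs_of_nonneg (sq_nonneg d), abs_of_nonneg hy0,
    mul_comm 2, mul_assoc]
  gcongr

lemma two_mul_abs_rpow_le (ha : 0 ≤ a) :
    2 * |u| ^ a ≤ |u + d| ^ a + |u - d| ^ a + 2 * |d| ^ a := by
  rcases le_total a 1 with ha1 | ha1
  · have hsubadd (x y : ℝ) : |x + y| ^ a ≤ |x| ^ a + |y| ^ a :=
      (Real.rpow_le_rpow (abs_nonneg _) (abs_add_le x y) ha).trans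
        (Real.rpow_add_le_add_rpow (abs_nonneg x) (abs_nonneg y) ha ha1)
    have hright := hsubadd (u + d) (-d)
    have hleft := hsubadd (u - d) d
    rw [add_neg_cancel_right, abs_neg] at hright
    rw [sub_add_cancel] at hleft
    linarith
  · have hmid : |u| ≤ 1 / 2 * |u + d| + 1 / 2 * |u - d| := by
      have := abs_add_le (u + d) (u - d)
      rw [add_add_sub_cancel, ← two_mul, abs_mul, abs_two] at this
      linarith
    have hconv := (convexOn_rpow ha1).2 (abs_nonneg (u + d)) (abs_nonneg (u - d))
      one_half_pos.le one_half_pos.le (add_halves 1)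
    simp only [smul_eq_mul] at hconv
    linarith [Real.rpow_le_rpow (abs_nonneg u) hmid ha, Real.rpow_nonneg (abs_nonneg d) a]

end SecondDifference

section NearFar

lemma setLIntegral_le_of_le_one_of_far {A : Set ℝ} (hA : MeasurableSet A) (hA1 : volume A ≤ 1)
    {f : ℝ → ℝ≥0∞} {s ρ : ℝ} {ε : ℝ≥0∞} (hf : ∀ t ∈ A, f t ≤ 1)
    (hfar : ∀ t ∈ A, ρ ≤ |s - t| → f t ≤ ε) :
    ∫⁻ t in A, f t ≤ ENNReal.ofReal (2 * ρ) + ε :=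
  calc ∫⁻ t in A, f t
      ≤ ∫⁻ t in A, ((Metric.ball s ρ).indicator 1 t + ε) := by
        refine setLIntegral_mono' hA fun t ht => ?_
        by_cases hts : t ∈ Metric.ball s ρ
        · rw [indicator_of_mem hts]
          exact (hf t ht).trans le_self_add
        · rw [Metric.mem_ball', Real.dist_eq, not_lt] at hts
          exact (hfar t ht hts).trans le_add_self
    _ = (∫⁻ t in A, (Metric.ball s ρ).indicator 1 t) + ε * volume A := by
        rw [lintegral_add_right _ measurable_const, setLIntegral_const]
    _ ≤ volume (Metric.ball s ρ) + ε := by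
        refine add_le_add ((setLIntegral_le_lintegral _ _).trans_eq ?_)
          (mul_le_of_le_one_right' hA1)
        rw [lintegral_indicator_one measurableSet_ball]
    _ = ENNReal.ofReal (2 * ρ) + ε := by rw [Real.volume_ball]

lemma summable_half_pow_rpow {γ : ℝ} (hγ : 0 < γ) :
    Summable fun n : ℕ => ((1 / 2 : ℝ) ^ n) ^ γ := by
  simp_rw [← Real.rpow_pow_comm one_half_pos.le]
  exact summable_geometric_of_lt_one (by positivity)
    (Real.rpow_lt_one one_half_pos.le one_half_lt_one hγ)

end NearFar

namespace IsSubfractionalBrownianMotion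

variable {Ω : Type*} [MeasurableSpace Ω] {P : Measure Ω} {H d s t : ℝ} {S : ℝ≥0 → Ω → ℝ}

lemma isGaussianProcess_comp_toNNReal (hS : IsSubfractionalBrownianMotion H S P) :
    IsGaussianProcess (fun t : ℝ => S t.toNNReal) P :=
  hS.isGaussianProcess.comp_right Real.toNNReal

lemma variance_le (hS : IsSubfractionalBrownianMotion H S P) (hH : 0 ≤ H)
    (ht : t ∈ Ioo (0 : ℝ) 1) : Var[S t.toNNReal; P] ≤ 2 := by
  rw [← covariance_self (hS.isGaussianProcess.hasGaussianLaw_eval _).aemeasurable,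
    hS.covariance_eq, Real.coe_toNNReal _ ht.1.le]
  have hle : t ^ (2 * H) ≤ 1 := Real.rpow_le_one ht.1.le ht.2.le (by positivity)
  have hsum : 0 ≤ (t + t) ^ (2 * H) := Real.rpow_nonneg (by linarith [ht.1]) _
  have hdiff : 0 ≤ |t - t| ^ (2 * H) := Real.rpow_nonneg (abs_nonneg _) _
  linarith

lemma covariance_fwdDiff (hS : IsSubfractionalBrownianMotion H S P) (hd : 0 ≤ d) (hs : 0 ≤ s)
    (ht : 0 ≤ t) :
    cov[Δ_[d] (fun t : ℝ => S t.toNNReal) s, Δ_[d] (fun t : ℝ => S t.toNNReal) t; P] =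
      (symmSecondDiff (fun x => |x| ^ (2 * H)) d (s - t) -
        symmSecondDiff (fun x => |x| ^ (2 * H)) d (s + t + d)) / 2 := by
  have := hS.isGaussianProcess.isProbabilityMeasure
  have hL2 (u : ℝ≥0) : MemLp (S u) 2 P := (hS.isGaussianProcess.hasGaussianLaw_eval u).memLp_two
  simp only [fwdDiff]
  rw [covariance_sub_left (hL2 _) (hL2 _) ((hL2 _).sub (hL2 _)),
    covariance_sub_right (hL2 _) (hL2 _) (hL2 _), covariance_sub_right (hL2 _) (hL2 _) (hL2 _)]
  simp only [hS.covariance_eq, Real.coe_toNNReal _ hs, Real.coe_toNNReal _ ht,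
    Real.coe_toNNReal _ (add_nonneg hs hd), Real.coe_toNNReal _ (add_nonneg ht hd), symmSecondDiff]
  rw [abs_of_nonneg (by positivity : 0 ≤ s + t + d + d), add_sub_cancel_right,
    abs_of_nonneg (by positivity : 0 ≤ s + t), abs_of_nonneg (by positivity : 0 ≤ s + t + d)]
  ring_nf

lemma variance_fwdDiff_le (hS : IsSubfractionalBrownianMotion H S P) (hH : 0 < H) (hd : 0 ≤ d)
    (hs : 0 ≤ s) : Var[Δ_[d] (fun t : ℝ => S t.toNNReal) s; P] ≤ 2 * d ^ (2 * H) := by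
  have hlaw :=
    (isGaussianProcess_fwdDiff hS.isGaussianProcess_comp_toNNReal d).hasGaussianLaw_eval s
  rw [← covariance_self hlaw.aemeasurable, hS.covariance_fwdDiff hd hs hs]
  have hbound := two_mul_abs_rpow_le (a := 2 * H) (u := s + s + d) (d := d) (by positivity)
  simp only [symmSecondDiff, sub_self, zero_add, zero_sub, abs_neg, abs_zero, abs_of_nonneg hd,
    Real.zero_rpow (by positivity : 2 * H ≠ 0)] at hbound ⊢
  linarith

lemma abs_covariance_fwdDiff_le (hS : IsSubfractionalBrownianMotion H S P) (hH0 : 0 ≤ H)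
    (hH1 : H ≤ 1) (hd : 0 < d) {r : ℝ} (hr : 0 < r) (hs : 0 ≤ s) (ht : 0 ≤ t)
    (hst : d + r ≤ |s - t|) :
    |cov[Δ_[d] (fun t : ℝ => S t.toNNReal) s, Δ_[d] (fun t : ℝ => S t.toNNReal) t; P]| ≤
      2 * d ^ 2 * r ^ (2 * H - 2) := by
  have hsum : d + r ≤ |s + t + d| := by
    have : |s - t| ≤ s + t := abs_le.2 ⟨by linarith, by linarith⟩
    exact le_abs.2 (.inl (by linarith))
  have hdiag := abs_symmSecondDiff_abs_rpow_le (a := 2 * H) (by linarith) (by linarith) hd hr hst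
  have hanti := abs_symmSecondDiff_abs_rpow_le (a := 2 * H) (by linarith) (by linarith) hd hr hsum
  rw [hS.covariance_fwdDiff hd.le hs ht, abs_div, abs_two, div_le_iff₀ two_pos, mul_two]
  exact (abs_sub _ _).trans (add_le_add hdiag hanti)

lemma abs_covariance_fwdDiff_div_le (hS : IsSubfractionalBrownianMotion H S P) (hH0 : 0 ≤ H)
    (hH1 : H ≤ 1) (hd : 0 < d) (hs : 0 ≤ s) (ht : 0 ≤ t) (hst : d + √d ≤ |s - t|) :
    |cov[Δ_[d] (fun t : ℝ => S t.toNNReal) s, Δ_[d] (fun t : ℝ => S t.toNNReal) t; P]| /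
      (2 * d ^ (2 * H)) ≤ d ^ (1 - H) := by
  rw [div_le_iff₀ (by positivity)]
  refine (hS.abs_covariance_fwdDiff_le hH0 hH1 hd (Real.sqrt_pos.2 hd) hs ht hst).trans_eq ?_
  rw [Real.sqrt_eq_rpow, ← Real.rpow_mul hd.le, ← Real.rpow_natCast, mul_assoc,
    mul_left_comm (_ ^ _), ← Real.rpow_add hd, ← Real.rpow_add hd]
  push_cast
  ring_nf

lemma setLIntegral_abs_covariance_fwdDiff_le (hS : IsSubfractionalBrownianMotion H S P)
    (hH0 : 0 < H) (hH1 : H ≤ 1) (hd : 0 < d) (hs : 0 ≤ s) :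
    ∫⁻ t in shiftDomain d, ENNReal.ofReal
      (|cov[Δ_[d] (fun t : ℝ => S t.toNNReal) s, Δ_[d] (fun t : ℝ => S t.toNNReal) t; P]| /
        (2 * d ^ (2 * H))) ≤ ENNReal.ofReal (2 * (d + √d) + d ^ (1 - H)) := by
  have := hS.isGaussianProcess.isProbabilityMeasure
  have hL2 (u : ℝ) := ((isGaussianProcess_fwdDiff hS.isGaussianProcess_comp_toNNReal
    d).hasGaussianLaw_eval u).memLp_two
  rw [ENNReal.ofReal_add (by positivity) (by positivity)]
  refine setLIntegral_le_of_le_one_of_far (s := s) (measurableSet_shiftDomain d)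
    (volume_shiftDomain_le_one d) (fun t ht => ?_) (fun t ht hst => ?_)
  · rw [ENNReal.ofReal_le_one, div_le_one (by positivity)]
    exact abs_covariance_le_of_variance_le (hL2 s) (hL2 t) (hS.variance_fwdDiff_le hH0 hd.le hs)
      (hS.variance_fwdDiff_le hH0 hd.le ht.1.1.le)
  · exact ENNReal.ofReal_le_ofReal
      (hS.abs_covariance_fwdDiff_div_le hH0.le hH1 hd hs ht.1.1.le hst)

theorem tsum_lintegral_abs_covariance_fwdDiff_ne_top (hS : IsSubfractionalBrownianMotion H S P)
    (hH0 : 0 < H) (hH1 : H < 1) :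
    ∑' n : ℕ, ∫⁻ s in shiftDomain ((1 / 2) ^ n), ∫⁻ t in shiftDomain ((1 / 2) ^ n),
      ENNReal.ofReal (|cov[Δ_[(1 / 2) ^ n] (fun t : ℝ => S t.toNNReal) s,
        Δ_[(1 / 2) ^ n] (fun t : ℝ => S t.toNNReal) t; P]| /
          (2 * ((1 / 2) ^ n) ^ (2 * H))) ≠ ∞ := by
  have hsummable : Summable fun n : ℕ =>
      2 * ((1 / 2 : ℝ) ^ n + √((1 / 2) ^ n)) + ((1 / 2 : ℝ) ^ n) ^ (1 - H) := by
    simp only [Real.sqrt_eq_rpow]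
    exact ((summable_geometric_two.add (summable_half_pow_rpow one_half_pos)).mul_left 2).add
      (summable_half_pow_rpow (sub_pos.2 hH1))
  refine ne_top_of_le_ne_top hsummable.tsum_ofReal_ne_top (ENNReal.tsum_le_tsum fun n => ?_)
  refine (setLIntegral_mono' (measurableSet_shiftDomain _) fun s hs =>
    hS.setLIntegral_abs_covariance_fwdDiff_le hH0 hH1.le (by positivity) hs.1.1.le).trans ?_
  rw [setLIntegral_const]
  exact mul_le_of_le_one_right' (volume_shiftDomain_le_one _)

end IsSubfractionalBrownianMotion

theorem mainTheorem3 {Ω : Type*} [MeasurableSpace Ω] (P : Measure Ω) [IsProbabilityMeasure P]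
    (H : ℝ) (hH0 : 0 < H) (hH1 : H < 1) (S : ℝ≥0 → Ω → ℝ)
    (hS : IsSubfractionalBrownianMotion H S P)
    (hmeas : AEMeasurable (fun x : ℝ × Ω => S x.1.toNNReal x.2)
      ((volume.restrict (Ioo (0 : ℝ) 1)).prod P)) :
    ∀ᵐ ω ∂P, (fun t : ℝ => S t.toNNReal ω) ∈ BesovOrliczSpace H 2 :=
  ae_mem_besovOrliczSpace_of_isGaussianProcess hH0 two_pos hS.isGaussianProcess_comp_toNNReal
    (fun t => hS.centred t.toNNReal) hmeas (fun _ => hS.variance_le hH0.le)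
    (fun _ _ hs => hS.variance_fwdDiff_le hH0 (by positivity) hs.1.1.le)
    (hS.tsum_lintegral_abs_covariance_fwdDiff_ne_top hH0 hH1)
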